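/- Fix integers $m\ge 2$, $K\ge 1$ and constants $c_0>0$, $C_0$. For each $n$ let $p=p_n$ be a dimension, $\mu\in\mathbb R^p$, let $\Sigma\in\mathbb R^{p\times p}$ be positive semidefinite, and let $Y_1,\dots,Y_n$ be i.i.d. random vectors with the elliptical distribution of $\mu+\xi\,\Sigma^{1/2}U$, where $U$ is uniform on the unit sphere of $\mathbb R^p$ and $\xi\ge 0$ is a random variable independent of $U$ with $\mathbb E\xi^2=p$ (all these objects may depend on $n$). Put $\theta_k=p^{-k}\,\mathbb E\,\xi^{2k}$. For $J\subset\{1,\dots,p\}$ let $v_J$ and $M_{JJ}$ denote the subvector and the principal submatrix indexed by $J$; let $c^*_{m,k}=p^m\,\mathbb E B^m$ with $B\sim\mathrm{Beta}(\tfrac k2,\tfrac{p-k}2)$ ($B=1$ if $k=p$). For a finite nonempty collection $\mathcal A=\mathcal A_n$ of nonempty subsets (blocks) of $\{1,\dots,p\}$ and (estimators) $\hat\mu$, $\hat\Sigma$, the blockwise aggregation estimator (BAE) is $$\hat\theta^{B}_m=\frac1{|\mathcal A|}\sum_{J\in\mathcal A}\frac1{n\,c^*_{m,|J|}}\sum_{i=1}^n\bigl\{(Y_{i,J}-\hat\mu_J)^{T}\,\hat\Sigma_{JJ}^{-1}\,(Y_{i,J}-\hat\mu_J)\bigr\}^m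 .$$ Assume that, as $n\to\infty$, $p\to\infty$ and $\log^{2m}(p)=o(n)$; that $\theta_{2m}\le C_0$ for all $n$ (in particular $\mathbb E\xi^{4m}<\infty$); that every $K\times K$ principal submatrix $\Sigma_{JJ}$, $|J|=K$, has smallest eigenvalue at least $c_0$; and that $\mathcal A$ is nonrandom and consists of pairwise disjoint blocks of size at most $K$. Let the random vector $\hat\mu$ and the random matrix $\hat\Sigma$ satisfy, with probability $1-o(1)$, $$\|\hat\mu-\mu\|_\infty\le\alpha_n\quad\text{and}\quad \max_{J\in\mathcal A}\|\hat\Sigma_{JJ}-\Sigma_{JJ}\|\le\beta_n ,$$ where $\|\cdot\|$ is the spectral norm and $\alpha_n\to0$, $\beta_n\to0$. Then for every $\epsilon>0$ there is a constant $C_\epsilon>0$, depending only on $\epsilon,m,K,c_0,C_0$, such that for all sufficiently large $n$, with probability at least $1-\epsilon$, $$|\hat\theta^{B}_m-\theta_m|\le C_\epsilon\bigl(n^{-1/2}+\max\{\alpha_n,\beta_n\}\bigr).$$ -/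

import Mathlib

open MeasureTheory ProbabilityTheory Filter Topology Asymptotics
open scoped Matrix MatrixOrder Matrix.Norms.L2Operator

universe u

namespace BlockAgg

noncomputable section

/-- The unit sphere of `ℝ^p`. -/
abbrev UnitSphere (p : ℕ) : Type := Metric.sphere (0 : EuclideanSpace ℝ (Fin p)) 1

/-- The uniform distribution on the unit sphere of `ℝ^p`: normalized surface measure. -/
def uniformSphere (p : ℕ) : Measure (UnitSphere p) :=
  ((volume : Measure (EuclideanSpace ℝ (Fin p))).toSphere Set.univ)⁻¹ •
    (volume : Measure (EuclideanSpace ℝ (Fin p))).toSphere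

/-- `ν` is admissible as the law of the radial variable `ξ` of an elliptical distribution on `ℝ^p`:
a probability law of a nonnegative random variable, normalized by `E ξ² = p`. -/
structure IsRadialLaw (p : ℕ) (ν : Measure ℝ) : Prop where
  isProbabilityMeasure : IsProbabilityMeasure ν
  nonneg : ∀ᵐ x ∂ν, 0 ≤ x
  integrable_sq : Integrable (fun x => x ^ 2) ν
  integral_sq : ∫ x, x ^ 2 ∂ν = p

/-- The elliptical distribution with mean `μ`, covariance matrix `S` and radial law `ν`: the law of
`μ + ξ S^{1/2} U`, with `ξ ∼ ν` independent of `U`, and `U` uniform on the unit sphere. -/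
def ellipticalLaw {p : ℕ} (μ : Fin p → ℝ) (S : Matrix (Fin p) (Fin p) ℝ) (ν : Measure ℝ) :
    Measure (Fin p → ℝ) :=
  (ν.prod (uniformSphere p)).map
    (fun x => μ + x.1 • (CFC.sqrt S *ᵥ (x.2 : EuclideanSpace ℝ (Fin p)).ofLp))

/-- The scaled even moment `θ_m = p^{-m} E ξ^{2m}`, with `ξ ∼ ν`. -/
def scaledMoment (p : ℕ) (ν : Measure ℝ) (m : ℕ) : ℝ :=
  ((p : ℝ) ^ m)⁻¹ * ∫ x, x ^ (2 * m) ∂ν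

/-- The law `Beta(k/2, (p-k)/2)` for `1 ≤ k ≤ p`; for `k = p` it is the point mass at `1`. -/
def betaLaw (p k : ℕ) : Measure ℝ :=
  if k < p then betaMeasure ((k : ℝ) / 2) (((p : ℝ) - (k : ℝ)) / 2) else Measure.dirac 1

/-- The constant `c*_{m,k} = p^m E B^m`, with `B ∼ Beta(k/2, (p-k)/2)`. -/
def cStar (p m k : ℕ) : ℝ :=
  (p : ℝ) ^ m * ∫ x, x ^ m ∂(betaLaw p k)

/-- The subvector `v_J`. -/
def subvec {p : ℕ} (v : Fin p → ℝ) (J : Finset (Fin p)) : J → ℝ := fun j => v j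

/-- The diagonal block `M_{JJ}`. -/
def diagBlock {p : ℕ} (M : Matrix (Fin p) (Fin p) ℝ) (J : Finset (Fin p)) : Matrix J J ℝ :=
  M.submatrix Subtype.val Subtype.val

lemma isHermitian_diagBlock {p : ℕ} {M : Matrix (Fin p) (Fin p) ℝ} (hM : M.PosSemidef)
    (J : Finset (Fin p)) : (diagBlock M J).IsHermitian :=
  hM.isHermitian.submatrix _

/-- The blockwise estimator of `θ_m` from the sample `Y_1, …, Y_n` and the block `J`, with `a` and
`S` used as mean vector and covariance matrix of the block. -/
def blockwiseEstimator {n p : ℕ} (m : ℕ) (Y : Fin n → Fin p → ℝ) (J : Finset (Fin p))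
    (a : J → ℝ) (S : Matrix J J ℝ) : ℝ :=
  ((n : ℝ) * cStar p m J.card)⁻¹ *
    ∑ i, ((subvec (Y i) J - a) ⬝ᵥ (S⁻¹ *ᵥ (subvec (Y i) J - a))) ^ m

/-- The blockwise aggregation estimator (BAE) of `θ_m` over the collection `A` of blocks, with `a`
as mean vector and the blocks `S_{JJ}`, `J ∈ A`, as covariance blocks. -/
def bae {n p : ℕ} (m : ℕ) (Y : Fin n → Fin p → ℝ) (A : Finset (Finset (Fin p)))
    (a : Fin p → ℝ) (S : Matrix (Fin p) (Fin p) ℝ) : ℝ :=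
  (A.card : ℝ)⁻¹ * ∑ J ∈ A, blockwiseEstimator m Y J (subvec a J) (diagBlock S J)

/-- `A` is a (nonempty) collection of non-overlapping (nonempty) blocks of size at most `K`. -/
structure IsBlockCollection {p : ℕ} (K : ℕ) (A : Finset (Finset (Fin p))) : Prop where
  nonempty : A.Nonempty
  block_nonempty : ∀ J ∈ A, J.Nonempty
  block_card_le : ∀ J ∈ A, J.card ≤ K
  disjoint : ∀ I ∈ A, ∀ J ∈ A, I ≠ J → Disjoint I J

end

end BlockAgg

/-! With the true $\mu$ and $\Sigma$ the estimator is an i.i.d. average. Normalized by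
$\Sigma_{JJ}$, the rows of $\Sigma^{1/2}$ in $J$ form an orthonormal family, so the block form of
$Y-\mu$ equals $\xi^2$ times the squared length of a projection of $U$
(`exists_orthonormal_quadForm_eq`). Polar coordinates for the Gaussian integral show that this
length has the Beta moments in $c^*_{m,k}$, so each block is exactly unbiased
(`integral_blockForm_pow`). Second moments are bounded by $\theta_{2m}$ times a constant free of $p$
(`integral_blockMean_sq_le`), and Chebyshev gives the $n^{-1/2}$ term.

Plugging in $\hat\mu,\hat\Sigma$ is handled for each outcome separately, so their dependence on the
sample is harmless. The largest eigenvalue of $\Sigma_{JJ}$ is not bounded, hence the perturbation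
bound must be relative: with $q$ the true quadratic form, the error is at most $\delta L(q+1)$,
where $L$ depends only on $c_0$ and $K$ (`abs_quadForm_inv_sub_le`). Taking $m$-th powers and
averaging keeps this shape, so the plug-in error is at most $\delta C_1(1+\text{oracle estimator})$
(`abs_bae_sub_le`), and the oracle estimator is bounded on the Chebyshev event. -/

namespace BlockAgg

/-! ### Moments of projections of a uniform point on the sphere -/

section SphereMoments

open Module Metric Set

variable {E : Type*} [NormedAddCommGroup E] [InnerProductSpace ℝ E] [FiniteDimensional ℝ E]
  [MeasurableSpace E] [BorelSpace E]

/-- Polar coordinates for the Gaussian integral of a function homogeneous of degree `2m`. -/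
lemma integral_homogeneous_mul_exp [Nontrivial E] (m : ℕ) (h : E → ℝ)
    (hh : ∀ (r : ℝ) (x : E), h (r • x) = r ^ (2 * m) * h x) :
    ∫ x : E, h x * Real.exp (-‖x‖ ^ 2) =
      (∫ u, h (u : E) ∂(volume : Measure E).toSphere) *
        ∫ r in Ioi (0 : ℝ), r ^ (finrank ℝ E - 1) * (r ^ (2 * m) * Real.exp (-r ^ 2)) := by
  calc
    ∫ x : E, h x * Real.exp (-‖x‖ ^ 2)
        = ∫ x : ({(0)}ᶜ : Set E), h x.1 * Real.exp (-‖x.1‖ ^ 2)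
            ∂((volume : Measure E).comap (↑)) := by
      rw [integral_subtype_comap (measurableSet_singleton _).compl
        fun x : E ↦ h x * Real.exp (-‖x‖ ^ 2), restrict_compl_singleton]
    _ = ∫ x : sphere (0 : E) 1 × Ioi (0 : ℝ),
          h x.1 * ((x.2 : ℝ) ^ (2 * m) * Real.exp (-(x.2 : ℝ) ^ 2))
            ∂(volume : Measure E).toSphere.prod (.volumeIoiPow (finrank ℝ E - 1)) := by
      rw [← ((volume : Measure E).measurePreserving_homeomorphUnitSphereProd).integral_comp
        (Homeomorph.measurableEmbedding _)]
      refine integral_congr_ae (.of_forall fun x ↦ ?_)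
      have hx : ‖(x : E)‖ ≠ 0 := norm_ne_zero_iff.2 x.2
      have : (x : E) = ‖(x : E)‖ • (‖(x : E)‖⁻¹ • (x : E)) := by
        rw [smul_smul, mul_inv_cancel₀ hx, one_smul]
      have key : h (x : E) = ‖(x : E)‖ ^ (2 * m) * h (‖(x : E)‖⁻¹ • (x : E)) := by
        conv_lhs => rw [this, hh]
      simp only [homeomorphUnitSphereProd_apply_snd_coe, homeomorphUnitSphereProd_apply_fst_coe]
      rw [key]; ring
    _ = (∫ u, h (u : E) ∂(volume : Measure E).toSphere) *
          ∫ r : Ioi (0 : ℝ), ((r : ℝ) ^ (2 * m) * Real.exp (-(r : ℝ) ^ 2))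
            ∂.volumeIoiPow (finrank ℝ E - 1) :=
      integral_prod_mul (fun u : sphere (0 : E) 1 ↦ h u)
        (fun r : Ioi (0 : ℝ) ↦ ((r : ℝ) ^ (2 * m) * Real.exp (-(r : ℝ) ^ 2)))
    _ = _ := by
      congr 1
      simp only [Measure.volumeIoiPow, ENNReal.ofReal]
      rw [integral_withDensity_eq_integral_smul,
        integral_subtype_comap measurableSet_Ioi fun a : ℝ ↦
          Real.toNNReal (a ^ (finrank ℝ E - 1)) • (a ^ (2 * m) * Real.exp (-a ^ 2)),
        setIntegral_congr_fun measurableSet_Ioi fun x hx ↦ ?_]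
      · rw [NNReal.smul_def, Real.coe_toNNReal _ (pow_nonneg hx.out.le _), smul_eq_mul]
      · exact (measurable_subtype_coe.pow_const _).real_toNNReal

lemma integral_pow_mul_exp_neg_sq {d : ℕ} (hd : 0 < d) (m : ℕ) :
    ∫ r in Ioi (0 : ℝ), r ^ (d - 1) * (r ^ (2 * m) * Real.exp (-r ^ 2)) =
      1 / 2 * Real.Gamma ((d : ℝ) / 2 + m) := by
  have h := integral_rpow_mul_exp_neg_rpow (p := 2) (q := (d : ℝ) - 1 + 2 * m) two_pos
    (by have : (0 : ℝ) < d := by exact_mod_cast hd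
        have : (0 : ℝ) ≤ m := by positivity
        linarith)
  rw [show ((d : ℝ) - 1 + 2 * m + 1) / 2 = (d : ℝ) / 2 + m by ring] at h
  refine Eq.trans ?_ h
  refine setIntegral_congr_fun measurableSet_Ioi fun r hr ↦ ?_
  have hr' : (0 : ℝ) < r := hr
  have e : ((d : ℝ) - 1 + 2 * m) = ((d - 1 + 2 * m : ℕ) : ℝ) := by
    push_cast [Nat.cast_pred hd]; ring
  change _ = r ^ (_ : ℝ) * Real.exp (-r ^ (2 : ℝ))
  rw [e, Real.rpow_natCast, pow_add, Real.rpow_two]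
  ring

/-- In polar coordinates this integral and the plain Gaussian integral carry the same surface area
as a factor, so the area cancels from their ratio. -/
lemma integral_norm_pow_mul_exp (hE : 0 < finrank ℝ E) (m : ℕ) :
    ∫ x : E, ‖x‖ ^ (2 * m) * Real.exp (-‖x‖ ^ 2) =
      Real.pi ^ ((finrank ℝ E : ℝ) / 2) *
        (Real.Gamma ((finrank ℝ E : ℝ) / 2 + m) / Real.Gamma ((finrank ℝ E : ℝ) / 2)) := by
  have : Nontrivial E := finrank_pos_iff.1 hE
  have hpos : (0 : ℝ) < (finrank ℝ E : ℝ) / 2 := by positivity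
  have hG := (Real.Gamma_pos_of_pos hpos).ne'
  have h0 : ∫ x : E, ‖x‖ ^ (2 * 0) * Real.exp (-‖x‖ ^ 2) =
      Real.pi ^ ((finrank ℝ E : ℝ) / 2) := by
    have := GaussianFourier.integral_rexp_neg_mul_sq_norm (V := E) one_pos
    simpa using this
  have key (m : ℕ) : ∫ x : E, ‖x‖ ^ (2 * m) * Real.exp (-‖x‖ ^ 2) =
      (volume : Measure E).toSphere.real univ *
        (1 / 2 * Real.Gamma ((finrank ℝ E : ℝ) / 2 + m)) := by
    rw [integral_homogeneous_mul_exp m (fun x : E ↦ ‖x‖ ^ (2 * m))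
      (fun r x ↦ by rw [norm_smul, mul_pow, pow_mul, pow_mul, pow_mul]; simp),
      integral_pow_mul_exp_neg_sq hE]
    simp
  rw [key 0, Nat.cast_zero, add_zero] at h0
  rw [key m, ← h0]
  field_simp

/-- The Gaussian integral of a power of the squared length of a coordinate block. -/
lemma integral_block_pow_mul_exp {p : ℕ} (J : Finset (Fin p)) (hJ : J.Nonempty) (m : ℕ) :
    ∫ x : EuclideanSpace ℝ (Fin p), (∑ j ∈ J, x j ^ 2) ^ m * Real.exp (-‖x‖ ^ 2) =
      Real.pi ^ ((p : ℝ) / 2) *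
        (Real.Gamma ((J.card : ℝ) / 2 + m) / Real.Gamma ((J.card : ℝ) / 2)) := by
  classical
  have hpres : MeasurePreserving (MeasurableEquiv.piEquivPiSubtypeProd (fun _ : Fin p ↦ ℝ) (· ∈ J))
      volume (volume : Measure (({i // i ∈ J} → ℝ) × ({i // ¬ i ∈ J} → ℝ))) := by
    convert! volume_preserving_piEquivPiSubtypeProd (fun _ : Fin p ↦ ℝ) (· ∈ J)
  have hsplit (m : ℕ) : ∫ x : EuclideanSpace ℝ (Fin p),
      (∑ j ∈ J, x j ^ 2) ^ m * Real.exp (-‖x‖ ^ 2) =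
      (∫ y : EuclideanSpace ℝ {i // i ∈ J}, ‖y‖ ^ (2 * m) * Real.exp (-‖y‖ ^ 2)) *
        ∫ z : EuclideanSpace ℝ {i // ¬ i ∈ J}, Real.exp (-‖z‖ ^ 2) := by
    rw [← (PiLp.volume_preserving_toLp (Fin p)).integral_comp
        (MeasurableEquiv.toLp 2 _).measurableEmbedding,
      ← (PiLp.volume_preserving_toLp {i // i ∈ J}).integral_comp
        (MeasurableEquiv.toLp 2 _).measurableEmbedding,
      ← (PiLp.volume_preserving_toLp {i // ¬ i ∈ J}).integral_comp
        (MeasurableEquiv.toLp 2 _).measurableEmbedding,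
      ← integral_prod_mul, ← Measure.volume_eq_prod]
    refine Eq.trans ?_ (hpres.integral_comp (MeasurableEquiv.measurableEmbedding _) _)
    refine integral_congr_ae (.of_forall fun x ↦ ?_)
    simp only [EuclideanSpace.real_norm_sq_eq, pow_mul, MeasurableEquiv.piEquivPiSubtypeProd,
      MeasurableEquiv.coe_mk, Equiv.piEquivPiSubtypeProd_apply]
    have hs : ∑ i, x i ^ 2 = ∑ i : {i // i ∈ J}, x i ^ 2 + ∑ i : {i // ¬ i ∈ J}, x i ^ 2 := by
      convert! (Fintype.sum_subtype_add_sum_subtype (fun i ↦ i ∈ J) (fun i ↦ x i ^ 2)).symm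
    rw [mul_assoc, ← Real.exp_add, ← neg_add, hs, ← Finset.sum_coe_sort J (fun j ↦ x j ^ 2)]
  have hfin : 0 < finrank ℝ (EuclideanSpace ℝ {i // i ∈ J}) := by
    simpa using hJ
  -- The case $m=0$ determines the integral over the coordinates outside `J`.
  have h0 := hsplit 0
  have hm := hsplit m
  rw [integral_norm_pow_mul_exp hfin] at h0 hm
  have hp := GaussianFourier.integral_rexp_neg_mul_sq_norm
    (V := EuclideanSpace ℝ (Fin p)) one_pos
  simp only [pow_zero, one_mul, neg_mul, div_one, finrank_euclideanSpace, Fintype.card_fin,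
    Nat.cast_zero, add_zero, Fintype.card_coe] at h0 hp hm
  have hG : Real.Gamma ((J.card : ℝ) / 2) ≠ 0 := by
    have : 0 < J.card := hJ.card_pos
    exact (Real.Gamma_pos_of_pos (by positivity)).ne'
  rw [hp, div_self hG, mul_one] at h0
  rw [hm, h0]
  ring

lemma isProbabilityMeasure_uniformSphere {p : ℕ} (hp : 0 < p) :
    IsProbabilityMeasure (uniformSphere p) := by
  have : Nonempty (Fin p) := ⟨⟨0, hp⟩⟩
  have : NeZero (volume : Measure (EuclideanSpace ℝ (Fin p))).toSphere :=
    ⟨Measure.toSphere_ne_zero _⟩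
  refine ⟨?_⟩
  rw [uniformSphere, Measure.smul_apply, smul_eq_mul]
  exact ENNReal.inv_mul_cancel (fun h ↦ this.out (Measure.measure_univ_eq_zero.1 h))
    (measure_ne_top _ _)

/-- Moments of the squared length of the projection of a uniform point of the sphere onto the span
of an orthonormal family. -/
lemma integral_uniformSphere_pow {p : ℕ} (J : Finset (Fin p)) (hJ : J.Nonempty)
    (v : J → EuclideanSpace ℝ (Fin p)) (hv : Orthonormal ℝ v) (m : ℕ) :
    ∫ u, (∑ j, inner ℝ (v j) (u : EuclideanSpace ℝ (Fin p)) ^ 2) ^ m ∂uniformSphere p =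
      (Real.Gamma ((J.card : ℝ) / 2 + m) / Real.Gamma ((J.card : ℝ) / 2)) /
        (Real.Gamma ((p : ℝ) / 2 + m) / Real.Gamma ((p : ℝ) / 2)) := by
  classical
  have hp : 0 < p := by obtain ⟨j, _⟩ := hJ; exact j.pos
  have : Nonempty (Fin p) := ⟨⟨0, hp⟩⟩
  let w : Fin p → EuclideanSpace ℝ (Fin p) := fun i ↦ if h : i ∈ J then v ⟨i, h⟩ else 0
  have hw : Orthonormal ℝ ((J : Set (Fin p)).domRestrict w) := by
    convert! hv using 1
    ext j : 1
    simp [w, Set.domRestrict]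
  obtain ⟨b, hb⟩ := Orthonormal.exists_orthonormalBasis_extension_of_card_eq
    (𝕜 := ℝ) (E := EuclideanSpace ℝ (Fin p)) (by simp) hw
  let h : EuclideanSpace ℝ (Fin p) → ℝ := fun x ↦ (∑ j, inner ℝ (v j) x ^ 2) ^ m
  -- Rotation invariance: `b.repr` preserves volume and norm and turns the projections on `v` into
  -- the coordinates in `J`.
  have hrot : ∫ x : EuclideanSpace ℝ (Fin p), h x * Real.exp (-‖x‖ ^ 2) =
      ∫ x : EuclideanSpace ℝ (Fin p), (∑ j ∈ J, x j ^ 2) ^ m * Real.exp (-‖x‖ ^ 2) := by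
    rw [← b.repr.measurePreserving.integral_comp b.repr.toHomeomorph.measurableEmbedding
      (fun x ↦ (∑ j ∈ J, x j ^ 2) ^ m * Real.exp (-‖x‖ ^ 2))]
    refine integral_congr_ae (.of_forall fun x ↦ ?_)
    simp only [h, LinearIsometryEquiv.norm_map]
    rw [← Finset.sum_coe_sort J]
    congr 3 with j
    rw [b.repr_apply_apply, hb j j.2]
    simp [w]
  have hpol := integral_homogeneous_mul_exp m h (fun r x ↦ by
    simp only [h, inner_smul_right, mul_pow, ← Finset.mul_sum, pow_mul])
  have hfin : 0 < finrank ℝ (EuclideanSpace ℝ (Fin p)) := by simpa using hp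
  rw [integral_pow_mul_exp_neg_sq hfin, hrot, integral_block_pow_mul_exp J hJ] at hpol
  -- The degree-zero instance gives the total surface mass by which `uniformSphere` is normalized.
  have hnorm := integral_homogeneous_mul_exp (E := EuclideanSpace ℝ (Fin p)) 0 (fun _ ↦ 1) (by simp)
  rw [integral_pow_mul_exp_neg_sq hfin] at hnorm
  have hg := GaussianFourier.integral_rexp_neg_mul_sq_norm (V := EuclideanSpace ℝ (Fin p)) one_pos
  simp only [one_mul, neg_mul, div_one] at hg hnorm
  rw [hg] at hnorm
  have hfr : finrank ℝ (EuclideanSpace ℝ (Fin p)) = p := by simp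
  rw [hfr] at hnorm hpol
  rw [uniformSphere, integral_smul_measure, smul_eq_mul, ENNReal.toReal_inv]
  simp only [integral_const, smul_eq_mul, mul_one, Nat.cast_zero, add_zero] at hnorm
  change ((volume : Measure (EuclideanSpace ℝ (Fin p))).toSphere.real Set.univ)⁻¹ *
    ∫ u : sphere (0 : EuclideanSpace ℝ (Fin p)) 1, h u ∂_ = _
  have hp2 : (0 : ℝ) < (p : ℝ) / 2 := by positivity
  have hG1 := (Real.Gamma_pos_of_pos hp2)
  have hG2 : 0 < Real.Gamma ((p : ℝ) / 2 + m) := Real.Gamma_pos_of_pos (by positivity)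
  have hpi : 0 < Real.pi ^ ((p : ℝ) / 2) := by positivity
  set I := ∫ u : sphere (0 : EuclideanSpace ℝ (Fin p)) 1, h u
    ∂(volume : Measure (EuclideanSpace ℝ (Fin p))).toSphere
  set V := (volume : Measure (EuclideanSpace ℝ (Fin p))).toSphere.real Set.univ
  have hV : V ≠ 0 := by
    rintro h0
    rw [h0, zero_mul] at hnorm
    exact hpi.ne' hnorm
  set R := Real.Gamma ((J.card : ℝ) / 2 + m) / Real.Gamma ((J.card : ℝ) / 2)
  rw [hnorm] at hpol
  field_simp at hpol ⊢
  linarith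

end SphereMoments

/-! ### Beta moments and bounds for $c^*_{m,k}$ -/

section BetaMoments

lemma Gamma_add_natCast_div {a : ℝ} (ha : 0 < a) (m : ℕ) :
    Real.Gamma (a + m) / Real.Gamma a = ∏ r ∈ Finset.range m, (a + r) := by
  have hG := (Real.Gamma_pos_of_pos ha).ne'
  induction m with
  | zero => simp [hG]
  | succ m ih =>
    rw [Finset.prod_range_succ, ← ih, Nat.cast_succ, ← add_assoc,
      Real.Gamma_add_one (by positivity)]
    ring

lemma betaPDFReal_nonneg {a b : ℝ} (ha : 0 < a) (hb : 0 < b) (x : ℝ) : 0 ≤ betaPDFReal a b x := by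
  by_cases h : 0 < x ∧ x < 1
  · exact (betaPDFReal_pos h.1 h.2 ha hb).le
  · simp [betaPDFReal, h]

lemma integral_betaPDFReal {a b : ℝ} (ha : 0 < a) (hb : 0 < b) :
    ∫ x, betaPDFReal a b x = 1 := by
  rw [integral_eq_lintegral_of_nonneg_ae (.of_forall (betaPDFReal_nonneg ha hb)) (by fun_prop)]
  change (∫⁻ x, betaPDF a b x).toReal = 1
  rw [lintegral_betaPDF_eq_one ha hb, ENNReal.toReal_one]

/-- Multiplying the Beta$(a,b)$ density by $x^m$ gives a multiple of the Beta$(a+m,b)$ density,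
which has total mass one. -/
lemma integral_pow_betaMeasure {a b : ℝ} (ha : 0 < a) (hb : 0 < b) (m : ℕ) :
    ∫ x, x ^ m ∂betaMeasure a b =
      (Real.Gamma (a + m) / Real.Gamma a) / (Real.Gamma (a + b + m) / Real.Gamma (a + b)) := by
  have ham : 0 < a + m := by positivity
  have hpt (x : ℝ) : betaPDFReal a b x * x ^ m =
      beta (a + m) b / beta a b * betaPDFReal (a + m) b x := by
    by_cases h : 0 < x ∧ x < 1
    · have h1 := (beta_pos ha hb).ne'
      have h2 := (beta_pos ham hb).ne'
      simp only [betaPDFReal, h, and_self, if_true]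
      rw [show a + m - 1 = a - 1 + m by ring, Real.rpow_add h.1, Real.rpow_natCast]
      field_simp
    · simp [betaPDFReal, h]
  have : ∫ x, x ^ m ∂betaMeasure a b = ∫ x, betaPDFReal a b x * x ^ m := by
    rw [betaMeasure, integral_withDensity_eq_integral_toReal_smul (f := betaPDF a b)
      (by unfold betaPDF; fun_prop) (.of_forall fun x ↦ by simp [betaPDF])]
    refine integral_congr_ae (.of_forall fun x ↦ ?_)
    simp [betaPDF, ENNReal.toReal_ofReal (betaPDFReal_nonneg ha hb x)]
  rw [this]
  simp_rw [hpt]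
  rw [integral_const_mul, integral_betaPDFReal ham hb, beta, beta]
  have h1 := (Real.Gamma_pos_of_pos ha).ne'
  have h2 := (Real.Gamma_pos_of_pos hb).ne'
  have h3 := (Real.Gamma_pos_of_pos ham).ne'
  have h4 := (Real.Gamma_pos_of_pos (add_pos ha hb)).ne'
  have h5 := (Real.Gamma_pos_of_pos (add_pos ham hb)).ne'
  rw [show a + b + m = a + m + b by ring]
  field_simp

/-- This is the Gamma quotient of `integral_uniformSphere_pow`, which ties $c^*_{m,k}$ to the
sphere. -/
lemma integral_pow_betaLaw {p k : ℕ} (hk : 0 < k) (hkp : k ≤ p) (m : ℕ) :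
    ∫ x, x ^ m ∂betaLaw p k =
      (Real.Gamma ((k : ℝ) / 2 + m) / Real.Gamma ((k : ℝ) / 2)) /
        (Real.Gamma ((p : ℝ) / 2 + m) / Real.Gamma ((p : ℝ) / 2)) := by
  have hk' : (0 : ℝ) < k := by exact_mod_cast hk
  rw [betaLaw]
  split_ifs with h
  · have h' : (k : ℝ) < p := by exact_mod_cast h
    rw [integral_pow_betaMeasure (by positivity) (by linarith),
      show (k : ℝ) / 2 + ((p : ℝ) - k) / 2 = p / 2 by ring]
  · obtain rfl : k = p := by omega
    rw [integral_dirac, one_pow, div_self]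
    exact (div_pos (Real.Gamma_pos_of_pos (by positivity))
      (Real.Gamma_pos_of_pos (by positivity))).ne'

lemma cStar_eq_prod {p k : ℕ} (hk : 0 < k) (hkp : k ≤ p) (m : ℕ) :
    cStar p m k = ∏ r ∈ Finset.range m, ((p : ℝ) * (k / 2 + r) / (p / 2 + r)) := by
  have hk' : (0 : ℝ) < k := by exact_mod_cast hk
  have hp' : (0 : ℝ) < p := by exact_mod_cast hk.trans_le hkp
  rw [cStar, integral_pow_betaLaw hk hkp, Gamma_add_natCast_div (by positivity),
    Gamma_add_natCast_div (by positivity), Finset.prod_div_distrib, Finset.prod_mul_distrib]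
  simp [mul_div_assoc]

/-- Every factor of the product is at least one. Hence dividing by $c^*_{m,k}$ never enlarges an
error. -/
lemma one_le_cStar {p k : ℕ} (hk : 0 < k) (hkp : k ≤ p) (m : ℕ) : 1 ≤ cStar p m k := by
  have hk' : (1 : ℝ) ≤ k := by exact_mod_cast hk
  have hkp' : (k : ℝ) ≤ p := by exact_mod_cast hkp
  rw [cStar_eq_prod hk hkp]
  rw [← Finset.prod_const_one (s := Finset.range m)]
  refine Finset.prod_le_prod (fun _ _ ↦ zero_le_one) fun r _ ↦ ?_
  have hp : (0 : ℝ) < p := by linarith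
  have hr : (0 : ℝ) ≤ r := r.cast_nonneg
  rw [one_le_div (by positivity)]
  nlinarith

/-- Since $p/(p/2+r)\le 2$, each factor is at most $k+2r$, uniformly in $p$. -/
lemma cStar_le {p k K : ℕ} (hk : 0 < k) (hkp : k ≤ p) (hkK : k ≤ K) (m : ℕ) :
    cStar p m k ≤ ((K : ℝ) + 2 * m) ^ m := by
  have hk' : (1 : ℝ) ≤ k := by exact_mod_cast hk
  have hkp' : (k : ℝ) ≤ p := by exact_mod_cast hkp
  have hkK' : (k : ℝ) ≤ K := by exact_mod_cast hkK
  rw [cStar_eq_prod hk hkp]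
  calc ∏ r ∈ Finset.range m, ((p : ℝ) * (k / 2 + r) / (p / 2 + r))
      ≤ ∏ _r ∈ Finset.range m, ((K : ℝ) + 2 * m) := by
        refine Finset.prod_le_prod (fun r _ ↦ by positivity) fun r hr ↦ ?_
        have hp : (0 : ℝ) < p := by linarith
        have hr0 : (0 : ℝ) ≤ r := r.cast_nonneg
        have hrm : (r : ℝ) ≤ m := by exact_mod_cast (Finset.mem_range.1 hr).le
        rw [div_le_iff₀ (by positivity)]
        have h1 : (p : ℝ) * (k / 2 + r) ≤ p * (K / 2 + m) := by gcongr
        have h2 : ((K : ℝ) + 2 * m) * (p / 2) ≤ (K + 2 * m) * (p / 2 + r) := by gcongr; linarith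
        linarith
    _ = _ := by simp

end BetaMoments

/-! ### Coercivity and whitening of principal blocks -/

section LinearAlgebra

lemma le_dotProduct_mulVec_of_le_eigenvalues {ι : Type*} [Fintype ι] [DecidableEq ι]
    {M : Matrix ι ι ℝ} (hM : M.IsHermitian) {c : ℝ} (hc : ∀ j, c ≤ hM.eigenvalues j)
    (x : ι → ℝ) : c * (x ⬝ᵥ x) ≤ x ⬝ᵥ (M *ᵥ x) := by
  have h : algebraMap ℝ (Matrix ι ι ℝ) c ≤ M := by
    rw [algebraMap_le_iff_le_spectrum (ha := hM)]
    intro y hy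
    rw [hM.spectrum_real_eq_range_eigenvalues] at hy
    obtain ⟨j, rfl⟩ := hy
    exact hc j
  have h2 := (Matrix.le_iff.1 h).dotProduct_mulVec_nonneg x
  rw [Matrix.sub_mulVec, dotProduct_sub, Algebra.algebraMap_eq_smul_one, Matrix.smul_mulVec,
    Matrix.one_mulVec, dotProduct_smul] at h2
  simpa using h2

/-- Coercivity passes from principal submatrices to smaller principal submatrices. -/
lemma le_dotProduct_diagBlock_mulVec {p K : ℕ} (hKp : K ≤ p) {S : Matrix (Fin p) (Fin p) ℝ}
    (hS : S.PosSemidef) {c : ℝ}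
    (hc : ∀ J : Finset (Fin p), J.card = K → ∀ j, c ≤ (isHermitian_diagBlock hS J).eigenvalues j)
    {J : Finset (Fin p)} (hJ : J.card ≤ K) (x : J → ℝ) :
    c * (x ⬝ᵥ x) ≤ x ⬝ᵥ (diagBlock S J *ᵥ x) := by
  classical
  -- The eigenvalue bound concerns blocks of size exactly `K`, so `J` is enlarged to such a block
  -- and `x` is padded by zeros.
  obtain ⟨I, hJI, -, hI⟩ := Finset.exists_subsuperset_card_eq (Finset.subset_univ J) hJ (by simpa)
  let X : Fin p → ℝ := fun i ↦ if h : i ∈ J then x ⟨i, h⟩ else 0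
  have hX (L : Finset (Fin p)) (hL : J ⊆ L) (f : Fin p → ℝ) :
      ∑ i : L, X i * f i = ∑ i : J, x i * f i := by
    rw [Finset.sum_coe_sort L (fun i ↦ X i * f i), ← Finset.sum_subset hL, ← Finset.sum_coe_sort J]
    · refine Finset.sum_congr rfl fun i _ ↦ ?_
      simp [X]
    · intro i _ hi
      simp [X, hi]
  have hXJ (i : J) : X i = x i := by simp [X]
  have h := le_dotProduct_mulVec_of_le_eigenvalues _ (hc I hI) (fun i ↦ X i)
  simp only [dotProduct, Matrix.mulVec, diagBlock, Matrix.submatrix_apply] at h ⊢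
  have e1 : ∑ i : I, X i * X i = ∑ i : J, x i * x i := by
    rw [hX I hJI X]; simp [hXJ]
  have e2 : ∑ i : I, X i * ∑ j : I, S i j * X j = ∑ i : J, x i * ∑ j : J, S i j * x j := by
    rw [hX I hJI (fun i ↦ ∑ j : I, S i j * X j)]
    refine Finset.sum_congr rfl fun i _ ↦ ?_
    simp only [mul_comm (S _ _)]
    rw [hX I hJI (fun j ↦ S i j)]
  rwa [e1, e2] at h

/-- In the direction of a principal block, `S^{1/2}` acts, up to normalization by `S_{JJ}`, as an
orthonormal family. -/
lemma exists_orthonormal_quadForm_eq {p : ℕ} {S : Matrix (Fin p) (Fin p) ℝ} (hS : S.PosSemidef)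
    {J : Finset (Fin p)} (hJ : (diagBlock S J).PosDef) :
    ∃ v : J → EuclideanSpace ℝ (Fin p), Orthonormal ℝ v ∧ ∀ u : EuclideanSpace ℝ (Fin p),
      subvec (CFC.sqrt S *ᵥ u.ofLp) J ⬝ᵥ
        ((diagBlock S J)⁻¹ *ᵥ subvec (CFC.sqrt S *ᵥ u.ofLp) J) = ∑ j, inner ℝ (v j) u ^ 2 := by
  classical
  set T := diagBlock S J with hT
  obtain ⟨B, hB⟩ : ∃ B : Matrix J J ℝ, T⁻¹ = Bᵀ * B := by
    have h := CFC.sqrt_mul_sqrt_self T⁻¹ hJ.inv.posSemidef.nonneg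
    have h2 : (CFC.sqrt T⁻¹).IsHermitian := (Matrix.nonneg_iff_posSemidef.1 (CFC.sqrt_nonneg T⁻¹)).isHermitian
    refine ⟨CFC.sqrt T⁻¹, ?_⟩
    rw [← Matrix.conjTranspose_eq_transpose_of_trivial, h2.eq, h]
  have hTu : IsUnit T := hJ.isUnit
  -- Cyclic rearrangement of $B^TBT=1$, as one-sided inverses of square matrices are two-sided. It
  -- makes the rows of `B * R` orthonormal, because `R * Rᵀ = T`.
  have hBT : B * T * Bᵀ = 1 := by
    have h1 : Bᵀ * (B * T) = 1 := by
      rw [← Matrix.mul_assoc, ← hB]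
      exact Matrix.nonsing_inv_mul _ ((Matrix.isUnit_iff_isUnit_det _).1 hTu)
    exact mul_eq_one_comm.1 h1
  let R : Matrix J (Fin p) ℝ := (CFC.sqrt S).submatrix Subtype.val id
  have hsym : (CFC.sqrt S)ᵀ = CFC.sqrt S := by
    have h2 : (CFC.sqrt S).IsHermitian := (Matrix.nonneg_iff_posSemidef.1 (CFC.sqrt_nonneg S)).isHermitian
    rw [← Matrix.conjTranspose_eq_transpose_of_trivial, h2.eq]
  have hR : R * Rᵀ = T := by
    have h := CFC.sqrt_mul_sqrt_self S hS.nonneg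
    rw [hT, diagBlock]
    conv_rhs => rw [← h]
    rw [Matrix.transpose_submatrix, hsym, Matrix.submatrix_mul _ _ _ id _ Function.bijective_id]
  refine ⟨fun j ↦ WithLp.toLp 2 ((B * R) j), ?_, fun u ↦ ?_⟩
  · rw [orthonormal_iff_ite]
    intro i j
    have h : (B * R) * (B * R)ᵀ = 1 := by
      rw [Matrix.transpose_mul, Matrix.mul_assoc, ← Matrix.mul_assoc R, hR, ← Matrix.mul_assoc,
        hBT]
    have h2 := congrFun (congrFun h i) j
    rw [Matrix.one_apply, Matrix.mul_apply] at h2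
    rw [← h2]
    simp [PiLp.inner_apply, mul_comm]
  · have hz : subvec (CFC.sqrt S *ᵥ u.ofLp) J = R *ᵥ u.ofLp := rfl
    rw [hz, hB, ← Matrix.mulVec_mulVec, Matrix.dotProduct_mulVec, Matrix.vecMul_transpose,
      Matrix.mulVec_mulVec, dotProduct]
    refine Finset.sum_congr rfl fun j _ ↦ ?_
    rw [← sq]
    congr 1
    simp [PiLp.inner_apply, Matrix.mulVec, dotProduct, mul_comm]

end LinearAlgebra

/-! ### Perturbation of inverse quadratic forms -/

section Perturbation

variable {ι : Type*} [Fintype ι]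

lemma abs_dotProduct_le_norm_toLp (x y : ι → ℝ) :
    |x ⬝ᵥ y| ≤ ‖WithLp.toLp 2 x‖ * ‖WithLp.toLp 2 y‖ := by
  have h := abs_real_inner_le_norm (WithLp.toLp 2 x) (WithLp.toLp 2 y)
  have e : inner ℝ (WithLp.toLp 2 x) (WithLp.toLp 2 y) = x ⬝ᵥ y := by
    simp [PiLp.inner_apply, dotProduct, mul_comm]
  rwa [e] at h

lemma norm_toLp_sq_eq_dotProduct (x : ι → ℝ) : ‖WithLp.toLp 2 x‖ ^ 2 = x ⬝ᵥ x := by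
  rw [EuclideanSpace.real_norm_sq_eq]
  simp [dotProduct, sq]

variable [DecidableEq ι]

lemma norm_toLp_mulVec_le (M : Matrix ι ι ℝ) (x : ι → ℝ) :
    ‖WithLp.toLp 2 (M *ᵥ x)‖ ≤ ‖M‖ * ‖WithLp.toLp 2 x‖ :=
  Matrix.l2_opNorm_mulVec M (WithLp.toLp 2 x)

/-- Coercivity forces a trivial kernel. No symmetry is needed, so this also covers an estimated
matrix that is not symmetric. -/
lemma isUnit_of_mulVec_bound {M : Matrix ι ι ℝ} {c : ℝ} (hc : 0 < c)
    (h : ∀ x : ι → ℝ, c * (x ⬝ᵥ x) ≤ x ⬝ᵥ (M *ᵥ x)) : IsUnit M := by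
  rw [← Matrix.mulVec_injective_iff_isUnit, ← Matrix.coe_mulVecLin, ← LinearMap.ker_eq_bot,
    LinearMap.ker_eq_bot']
  intro x hx
  have h1 := h x
  rw [Matrix.mulVecLin_apply] at hx
  rw [hx, dotProduct_zero, ← norm_toLp_sq_eq_dotProduct] at h1
  have h2 : ‖WithLp.toLp 2 x‖ ^ 2 ≤ 0 := by nlinarith
  have h3 : ‖WithLp.toLp 2 x‖ = 0 := by
    have := sq_nonneg ‖WithLp.toLp 2 x‖
    exact pow_eq_zero_iff two_ne_zero |>.1 (le_antisymm h2 this)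
  simpa using h3

/-- Stability of the quadratic form of an inverse matrix. The bound does not involve the norm of
`T`. -/
lemma abs_quadForm_inv_sub_le {T T' : Matrix ι ι ℝ} {c δ k : ℝ} (hc : 0 < c) (hk : 0 ≤ k)
    (hT : T.IsHermitian) (hTc : ∀ x : ι → ℝ, c * (x ⬝ᵥ x) ≤ x ⬝ᵥ (T *ᵥ x))
    (hδ1 : δ ≤ 1) (hδc : δ ≤ c / 2) (hE : ‖T' - T‖ ≤ δ) (y d : ι → ℝ)
    (hd : ‖WithLp.toLp 2 d‖ ≤ k * δ) :
    |(y - d) ⬝ᵥ (T'⁻¹ *ᵥ (y - d)) - y ⬝ᵥ (T⁻¹ *ᵥ y)| ≤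
      δ * ((1 + 2 / c) * (2 * (y ⬝ᵥ (T⁻¹ *ᵥ y) / c + k ^ 2))) := by
  have hδ0 : 0 ≤ δ := (norm_nonneg _).trans hE
  set E := T' - T with hEdef
  have hT' : T' = T + E := by simp [E]
  have hT'c (x : ι → ℝ) : c / 2 * (x ⬝ᵥ x) ≤ x ⬝ᵥ (T' *ᵥ x) := by
    rw [hT', Matrix.add_mulVec, dotProduct_add]
    have h1 := hTc x
    have h2 := abs_dotProduct_le_norm_toLp x (E *ᵥ x)
    have h3 := norm_toLp_mulVec_le E x
    have h4 : ‖WithLp.toLp 2 x‖ * ‖WithLp.toLp 2 (E *ᵥ x)‖ ≤ c / 2 * (x ⬝ᵥ x) := by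
      rw [← norm_toLp_sq_eq_dotProduct]
      calc _ ≤ ‖WithLp.toLp 2 x‖ * (c / 2 * ‖WithLp.toLp 2 x‖) := by
            gcongr
            exact h3.trans (by gcongr; exact hE.trans hδc)
        _ = _ := by ring
    have h5 := (abs_le.1 (h2.trans h4)).1
    linarith
  have hTu := (Matrix.isUnit_iff_isUnit_det _).1 (isUnit_of_mulVec_bound hc hTc)
  have hTu' := (Matrix.isUnit_iff_isUnit_det _).1 (isUnit_of_mulVec_bound (half_pos hc) hT'c)
  set u := T⁻¹ *ᵥ y
  set w := T'⁻¹ *ᵥ (y - d)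
  have hTuy : T *ᵥ u = y := by
    simp only [u]; rw [Matrix.mulVec_mulVec, Matrix.mul_nonsing_inv _ hTu, Matrix.one_mulVec]
  have hTw : T' *ᵥ w = y - d := by
    simp only [w]; rw [Matrix.mulVec_mulVec, Matrix.mul_nonsing_inv _ hTu', Matrix.one_mulVec]
  set z := w - u
  have hz : T' *ᵥ z = -(E *ᵥ u + d) := by
    simp only [z]
    rw [Matrix.mulVec_sub, hTw, hT', Matrix.add_mulVec, hTuy]
    abel
  have hq0 : c * ‖WithLp.toLp 2 u‖ ^ 2 ≤ y ⬝ᵥ u := by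
    rw [norm_toLp_sq_eq_dotProduct, dotProduct_comm y u]
    conv_rhs => rw [← hTuy]
    exact hTc u
  set s := ‖WithLp.toLp 2 u‖
  have hs0 : 0 ≤ s := norm_nonneg _
  have hEu : ‖WithLp.toLp 2 (E *ᵥ u)‖ ≤ δ * s :=
    (norm_toLp_mulVec_le E u).trans (by gcongr)
  have hEud : ‖WithLp.toLp 2 (E *ᵥ u + d)‖ ≤ δ * (s + k) := by
    rw [WithLp.toLp_add]
    refine (norm_add_le _ _).trans ?_
    linarith
  have hznorm : ‖WithLp.toLp 2 z‖ ≤ 2 / c * (δ * (s + k)) := by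
    have h1 := hT'c z
    rw [hz, ← norm_toLp_sq_eq_dotProduct] at h1
    have h2 := (abs_le.1 (abs_dotProduct_le_norm_toLp z (-(E *ᵥ u + d)))).2
    rw [WithLp.toLp_neg, norm_neg] at h2
    rcases (norm_nonneg (WithLp.toLp 2 z)).eq_or_lt with h0 | h0
    · rw [← h0]; positivity
    · have h3 : c / 2 * ‖WithLp.toLp 2 z‖ ≤ ‖WithLp.toLp 2 (E *ᵥ u + d)‖ := by
        refine le_of_mul_le_mul_left ?_ h0
        nlinarith
      calc ‖WithLp.toLp 2 z‖ = 2 / c * (c / 2 * ‖WithLp.toLp 2 z‖) := by field_simp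
        _ ≤ _ := mul_le_mul_of_nonneg_left (h3.trans hEud) (by positivity)
  have hzn0 : 0 ≤ ‖WithLp.toLp 2 z‖ := norm_nonneg _
  have hEz : ‖WithLp.toLp 2 (E *ᵥ z)‖ ≤ δ * (2 / c * (δ * (s + k))) :=
    (norm_toLp_mulVec_le E z).trans (by gcongr)
  have hw : w = u + z := by simp [z]
  -- Bounding $y\cdot z$ by norms would bring in the norm of $T$. Instead $y=Tu$ and the symmetry of
  -- $T$ move $T$ onto $z$, where $Tz=T'z-Ez$ is small.
  have hyz : y ⬝ᵥ z = -(u ⬝ᵥ (E *ᵥ u + d)) - u ⬝ᵥ (E *ᵥ z) := by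
    have h1 : y ⬝ᵥ z = u ⬝ᵥ (T *ᵥ z) := by
      rw [Matrix.dotProduct_mulVec, ← Matrix.mulVec_transpose,
        ← Matrix.conjTranspose_eq_transpose_of_trivial, hT.eq, hTuy]
    have h2 : T *ᵥ z = T' *ᵥ z - E *ᵥ z := by rw [hT', Matrix.add_mulVec]; abel
    rw [h1, h2, hz, dotProduct_sub, dotProduct_neg]
  have hdiff : (y - d) ⬝ᵥ w - y ⬝ᵥ u =
      -(u ⬝ᵥ (E *ᵥ u + d)) - u ⬝ᵥ (E *ᵥ z) - d ⬝ᵥ u - d ⬝ᵥ z := by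
    rw [hw, sub_dotProduct, dotProduct_add, dotProduct_add, hyz]
    ring
  have b1 : |u ⬝ᵥ (E *ᵥ u + d)| ≤ s * (δ * (s + k)) :=
    (abs_dotProduct_le_norm_toLp _ _).trans (by gcongr)
  have b2 : |u ⬝ᵥ (E *ᵥ z)| ≤ s * (δ * (2 / c * (δ * (s + k)))) :=
    (abs_dotProduct_le_norm_toLp _ _).trans (by gcongr)
  have b3 : |d ⬝ᵥ u| ≤ (k * δ) * s :=
    (abs_dotProduct_le_norm_toLp _ _).trans (by gcongr)
  have b4 : |d ⬝ᵥ z| ≤ (k * δ) * (2 / c * (δ * (s + k))) :=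
    (abs_dotProduct_le_norm_toLp _ _).trans (by gcongr)
  -- Second-order terms in $\delta$ are absorbed into first-order ones by $\delta\le1$.
  have hδs : δ * (s + k) ≤ s + k := mul_le_of_le_one_left (by positivity) hδ1
  have b2' : s * (δ * (2 / c * (δ * (s + k)))) ≤ s * (δ * (2 / c * (s + k))) := by gcongr
  have b4' : (k * δ) * (2 / c * (δ * (s + k))) ≤ (k * δ) * (2 / c * (s + k)) := by gcongr
  rw [hdiff]
  have hsq : (s + k) ^ 2 ≤ 2 * (y ⬝ᵥ u / c + k ^ 2) := by
    have : s ^ 2 ≤ y ⬝ᵥ u / c := by rw [le_div_iff₀ hc]; linarith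
    nlinarith [sq_nonneg (s - k)]
  calc _ ≤ s * (δ * (s + k)) + s * (δ * (2 / c * (s + k))) + (k * δ) * s
          + (k * δ) * (2 / c * (s + k)) := by
        rw [abs_le] at *
        constructor <;> linarith [b1.1, b1.2, b2.1, b2.2, b3.1, b3.2, b4.1, b4.2]
    _ ≤ δ * ((1 + 2 / c) * (s + k) ^ 2) := by
        have : 0 ≤ δ * k ^ 2 := by positivity
        nlinarith
    _ ≤ _ := by gcongr

end Perturbation

/-! ### Block forms and the estimator as a sample average -/

section BlockForms

/-- The squared Mahalanobis length of the subvector `z_J` with respect to `S_{JJ}`. -/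
noncomputable def blockForm {p : ℕ} (S : Matrix (Fin p) (Fin p) ℝ) (J : Finset (Fin p))
    (z : Fin p → ℝ) : ℝ :=
  subvec z J ⬝ᵥ ((diagBlock S J)⁻¹ *ᵥ subvec z J)

/-- The contribution of a single centred observation `z` to the aggregated estimator. -/
noncomputable def blockMean {p : ℕ} (m : ℕ) (A : Finset (Finset (Fin p)))
    (S : Matrix (Fin p) (Fin p) ℝ) (z : Fin p → ℝ) : ℝ :=
  (A.card : ℝ)⁻¹ * ∑ J ∈ A, (cStar p m J.card)⁻¹ * blockForm S J z ^ m

lemma bae_eq_average {n p : ℕ} (m : ℕ) (Y : Fin n → Fin p → ℝ) (A : Finset (Finset (Fin p)))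
    (a : Fin p → ℝ) (S : Matrix (Fin p) (Fin p) ℝ) :
    bae m Y A a S = (n : ℝ)⁻¹ * ∑ i, blockMean m A S (Y i - a) := by
  have h (J : Finset (Fin p)) : blockwiseEstimator m Y J (subvec a J) (diagBlock S J) =
      (n : ℝ)⁻¹ * ∑ i, (cStar p m J.card)⁻¹ * blockForm S J (Y i - a) ^ m := by
    rw [blockwiseEstimator, mul_inv, mul_assoc, ← Finset.mul_sum]
    rfl
  simp only [bae, h, blockMean]
  rw [← Finset.mul_sum, Finset.sum_comm, ← Finset.mul_sum]
  ring

lemma blockForm_smul {p : ℕ} (S : Matrix (Fin p) (Fin p) ℝ) (J : Finset (Fin p))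
    (r : ℝ) (z : Fin p → ℝ) : blockForm S J (r • z) = r ^ 2 * blockForm S J z := by
  have h : subvec (r • z) J = r • subvec z J := rfl
  rw [blockForm, h, Matrix.mulVec_smul, dotProduct_smul, smul_dotProduct, blockForm]
  simp only [smul_eq_mul]
  ring

lemma continuous_blockForm {p : ℕ} (S : Matrix (Fin p) (Fin p) ℝ) (J : Finset (Fin p)) :
    Continuous (blockForm S J) := by
  have h : Continuous fun z : Fin p → ℝ ↦ subvec z J := by
    unfold subvec; fun_prop
  unfold blockForm
  exact h.dotProduct (continuous_const.matrix_mulVec h)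

lemma continuous_blockMean {p : ℕ} (m : ℕ) (A : Finset (Finset (Fin p)))
    (S : Matrix (Fin p) (Fin p) ℝ) : Continuous (blockMean m A S) := by
  have := continuous_blockForm S
  unfold blockMean
  fun_prop

lemma blockForm_nonneg {p : ℕ} {S : Matrix (Fin p) (Fin p) ℝ} (hS : S.PosSemidef)
    (J : Finset (Fin p)) (z : Fin p → ℝ) : 0 ≤ blockForm S J z := by
  have h : (diagBlock S J).PosSemidef := hS.submatrix _
  simpa [blockForm] using h.inv.dotProduct_mulVec_nonneg (subvec z J)

end BlockForms

/-! ### Stability of the averaged powers -/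

section Stability

/-- Both bases are at most $(1+L)(q+1)$, and $(q+1)^m\le 2^m(q^m+1)$. The error thus stays relative
to $q^m+1$, a quantity that can be averaged. -/
lemma abs_pow_sub_pow_le_of_relative {q q' δ L : ℝ} (hq : 0 ≤ q) (hδ0 : 0 ≤ δ) (hδ1 : δ ≤ 1)
    (hL : 0 ≤ L) (h : |q' - q| ≤ δ * (L * (q + 1))) (m : ℕ) :
    |q' ^ m - q ^ m| ≤ δ * (L * m * (1 + L) ^ m * 2 ^ m * (q ^ m + 1)) := by
  have hq1 : 0 ≤ L * (q + 1) := by positivity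
  have hmax : max |q'| |q| ≤ (1 + L) * (q + 1) := by
    have h1 : |q'| ≤ |q' - q| + |q| := by simpa using abs_add_le (q' - q) q
    have h2 : δ * (L * (q + 1)) ≤ L * (q + 1) := mul_le_of_le_one_left hq1 hδ1
    rw [abs_of_nonneg hq] at h1 ⊢
    refine max_le ?_ ?_ <;> nlinarith
  rcases m.eq_zero_or_pos with rfl | hm
  · simp
  have h2m : (q + 1) ^ m ≤ 2 ^ m * (q ^ m + 1) := by
    have := add_pow_le hq zero_le_one m
    rw [one_pow] at this
    refine this.trans ?_
    gcongr
    · exact one_le_two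
    · omega
  have hb : (1 : ℝ) ≤ 1 + L := by linarith
  calc |q' ^ m - q ^ m| ≤ |q' - q| * m * max |q'| |q| ^ (m - 1) := abs_pow_sub_pow_le ..
    _ ≤ δ * (L * (q + 1)) * m * ((1 + L) * (q + 1)) ^ (m - 1) := by gcongr
    _ = δ * (L * m * (1 + L) ^ (m - 1) * (q + 1) ^ m) := by
        obtain ⟨k, rfl⟩ := Nat.exists_eq_add_of_le' hm
        rw [mul_pow, Nat.add_sub_cancel, pow_succ (q + 1)]
        ring
    _ ≤ δ * (L * m * (1 + L) ^ m * (2 ^ m * (q ^ m + 1))) := by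
        gcongr
        omega
    _ = _ := by ring

/-- The Lipschitz constant of the aggregated estimator in its nuisance parameters. -/
noncomputable def stabilityConst (m K : ℕ) (c : ℝ) : ℝ :=
  let L := (1 + 2 / c) * (2 * (1 / c + (K : ℝ) ^ 2))
  L * m * (1 + L) ^ m * 2 ^ m

lemma stabilityConst_nonneg (m K : ℕ) {c : ℝ} (hc : 0 < c) : 0 ≤ stabilityConst m K c := by
  unfold stabilityConst
  positivity

lemma norm_toLp_subvec_le {p K : ℕ} {J : Finset (Fin p)} (hJ : J.card ≤ K)
    {d : Fin p → ℝ} {δ : ℝ} (hd : ‖d‖ ≤ δ) : ‖WithLp.toLp 2 (subvec d J)‖ ≤ K * δ := by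
  have hδ : 0 ≤ δ := (norm_nonneg d).trans hd
  refine abs_le_of_sq_le_sq' ?_ (by positivity) |>.2
  rw [norm_toLp_sq_eq_dotProduct, dotProduct]
  -- The sharp factor is $\sqrt{|J|}$; the cruder $K$ avoids a root.
  have hKK : (J.card : ℝ) ≤ (K : ℝ) ^ 2 := by
    have : J.card ≤ K ^ 2 := hJ.trans (Nat.le_self_pow two_ne_zero K)
    exact_mod_cast this
  calc ∑ i : J, subvec d J i * subvec d J i ≤ ∑ _i : J, δ ^ 2 := by
        refine Finset.sum_le_sum fun i _ ↦ ?_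
        rw [← sq, ← sq_abs]
        have : |subvec d J i| ≤ δ := (norm_le_pi_norm d i).trans hd
        gcongr
    _ = J.card * δ ^ 2 := by simp
    _ ≤ (K : ℝ) ^ 2 * δ ^ 2 := by gcongr
    _ = _ := by ring

lemma abs_blockMean_sub_le {p m K : ℕ} {A : Finset (Finset (Fin p))}
    (hA : IsBlockCollection K A) {S S' : Matrix (Fin p) (Fin p) ℝ} (hS : S.PosSemidef)
    {c δ : ℝ} (hc : 0 < c)
    (hSc : ∀ J ∈ A, ∀ x : J → ℝ, c * (x ⬝ᵥ x) ≤ x ⬝ᵥ (diagBlock S J *ᵥ x))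
    (hcs : ∀ J ∈ A, 1 ≤ cStar p m J.card)
    (hδ0 : 0 ≤ δ) (hδ1 : δ ≤ 1) (hδc : δ ≤ c / 2)
    (hE : ∀ J ∈ A, ‖diagBlock S' J - diagBlock S J‖ ≤ δ) (y d : Fin p → ℝ) (hd : ‖d‖ ≤ δ) :
    |blockMean m A S' (y - d) - blockMean m A S y| ≤
      δ * (stabilityConst m K c * (1 + blockMean m A S y)) := by
  set C := stabilityConst m K c with hC
  have hC0 : 0 ≤ C := stabilityConst_nonneg m K hc
  have hblock (J) (hJ : J ∈ A) :
      |(cStar p m J.card)⁻¹ * blockForm S' J (y - d) ^ m -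
        (cStar p m J.card)⁻¹ * blockForm S J y ^ m| ≤
        δ * (C * (1 + (cStar p m J.card)⁻¹ * blockForm S J y ^ m)) := by
    have h1 : |blockForm S' J (y - d) - blockForm S J y| ≤
        δ * ((1 + 2 / c) * (2 * (blockForm S J y / c + (K : ℝ) ^ 2))) :=
      abs_quadForm_inv_sub_le hc K.cast_nonneg (isHermitian_diagBlock hS J) (hSc J hJ) hδ1 hδc
        (hE J hJ) (subvec y J) (subvec d J) (norm_toLp_subvec_le (hA.block_card_le J hJ) hd)
    have hq := blockForm_nonneg hS J y
    have h2 := abs_pow_sub_pow_le_of_relative hq hδ0 hδ1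
      (L := (1 + 2 / c) * (2 * (1 / c + (K : ℝ) ^ 2))) (by positivity) (h1.trans ?_) m
    · have hci : 0 ≤ (cStar p m J.card)⁻¹ := inv_nonneg.2 (zero_le_one.trans (hcs J hJ))
      rw [← mul_sub, abs_mul, abs_of_nonneg hci]
      calc _ ≤ (cStar p m J.card)⁻¹ * (δ * (C * (blockForm S J y ^ m + 1))) := by
            gcongr
            exact h2
        _ = δ * (C * ((cStar p m J.card)⁻¹ + (cStar p m J.card)⁻¹ * blockForm S J y ^ m)) := by
            ring
        _ ≤ _ := by
            gcongr
            exact inv_le_one_of_one_le₀ (hcs J hJ)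
    · rw [mul_assoc (1 + 2 / c), mul_assoc 2]
      gcongr
      have : (0 : ℝ) ≤ 1 / c := by positivity
      rw [div_eq_mul_one_div]
      nlinarith [sq_nonneg (K : ℝ)]
  have hcard : (0 : ℝ) < A.card := by exact_mod_cast hA.nonempty.card_pos
  rw [blockMean, blockMean, ← mul_sub, ← Finset.sum_sub_distrib, abs_mul,
    abs_of_nonneg (by positivity)]
  calc _ ≤ (A.card : ℝ)⁻¹ *
        ∑ J ∈ A, δ * (C * (1 + (cStar p m J.card)⁻¹ * blockForm S J y ^ m)) := by
        gcongr
        exact (Finset.abs_sum_le_sum_abs _ _).trans (Finset.sum_le_sum hblock)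
    _ = _ := by
        simp only [← Finset.mul_sum, Finset.sum_add_distrib]
        simp only [Finset.sum_const, nsmul_eq_mul, mul_one]
        field_simp

end Stability

/-! ### Moments under the elliptical law -/

section EllipticalMoments

variable {p : ℕ} {S : Matrix (Fin p) (Fin p) ℝ} {ν : Measure ℝ}

lemma continuous_ellipticalMap (μ : Fin p → ℝ) (S : Matrix (Fin p) (Fin p) ℝ) :
    Continuous (fun x : ℝ × UnitSphere p =>
      μ + x.1 • (CFC.sqrt S *ᵥ (x.2 : EuclideanSpace ℝ (Fin p)).ofLp)) := by
  have h : Continuous fun x : ℝ × UnitSphere p ↦ (x.2 : EuclideanSpace ℝ (Fin p)).ofLp :=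
    (PiLp.continuous_ofLp 2 _).comp (continuous_subtype_val.comp continuous_snd)
  exact continuous_const.add (continuous_fst.smul (continuous_const.matrix_mulVec h))

lemma continuous_blockForm_sub_pow (S : Matrix (Fin p) (Fin p) ℝ) (J : Finset (Fin p))
    (μ : Fin p → ℝ) (m : ℕ) : Continuous fun x ↦ blockForm S J (x - μ) ^ m :=
  ((continuous_blockForm S J).comp (continuous_sub_right μ)).pow m

lemma blockForm_elliptical (μ : Fin p → ℝ) (J : Finset (Fin p)) (m : ℕ)
    (x : ℝ × UnitSphere p) :
    blockForm S J (μ + x.1 • (CFC.sqrt S *ᵥ (x.2 : EuclideanSpace ℝ (Fin p)).ofLp) - μ) ^ m =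
      x.1 ^ (2 * m) *
        blockForm S J (CFC.sqrt S *ᵥ (x.2 : EuclideanSpace ℝ (Fin p)).ofLp) ^ m := by
  rw [add_sub_cancel_left, blockForm_smul, mul_pow, ← pow_mul]

/-- The block forms of an elliptical vector have moments `c*_{m,k} θ_m`. -/
lemma integral_blockForm_pow (hS : S.PosSemidef) (hν : IsRadialLaw p ν) (μ : Fin p → ℝ)
    {J : Finset (Fin p)} (hJ : J.Nonempty) (hJS : (diagBlock S J).PosDef) (m : ℕ) :
    ∫ x, blockForm S J (x - μ) ^ m ∂ellipticalLaw μ S ν =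
      cStar p m J.card * scaledMoment p ν m := by
  have hp : 0 < p := by obtain ⟨j, _⟩ := hJ; exact j.pos
  have := hν.isProbabilityMeasure
  have := isProbabilityMeasure_uniformSphere hp
  obtain ⟨v, hv, hvS⟩ := exists_orthonormal_quadForm_eq hS hJS
  rw [ellipticalLaw, integral_map (continuous_ellipticalMap μ S).measurable.aemeasurable
    (continuous_blockForm_sub_pow S J μ m).aestronglyMeasurable]
  simp only [blockForm_elliptical]
  rw [integral_prod_mul (fun x : ℝ ↦ x ^ (2 * m))
    (fun u : UnitSphere p ↦
      blockForm S J (CFC.sqrt S *ᵥ (u : EuclideanSpace ℝ (Fin p)).ofLp) ^ m)]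
  -- After $\xi$ and $U$ separate, the spherical factor is the Beta moment, and the powers of $p$ in
  -- $c^*_{m,k}$ and $\theta_m$ cancel.
  have h : ∫ u : UnitSphere p,
      blockForm S J (CFC.sqrt S *ᵥ (u : EuclideanSpace ℝ (Fin p)).ofLp) ^ m ∂uniformSphere p =
      ∫ x, x ^ m ∂betaLaw p J.card := by
    rw [integral_pow_betaLaw hJ.card_pos (by simpa using J.card_le_univ),
      ← integral_uniformSphere_pow J hJ v hv m]
    simp only [blockForm, hvS]
  rw [h, cStar, scaledMoment]
  have hp' : (p : ℝ) ^ m ≠ 0 := by positivity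
  field_simp

lemma integrable_blockForm_pow (hp : 0 < p) (hν : IsRadialLaw p ν) (μ : Fin p → ℝ)
    (J : Finset (Fin p)) {m : ℕ} (hm : Integrable (fun x ↦ x ^ (2 * m)) ν) :
    Integrable (fun x ↦ blockForm S J (x - μ) ^ m) (ellipticalLaw μ S ν) := by
  have := hν.isProbabilityMeasure
  have := isProbabilityMeasure_uniformSphere hp
  rw [ellipticalLaw, integrable_map_measure
    (continuous_blockForm_sub_pow S J μ m).aestronglyMeasurable
    (continuous_ellipticalMap μ S).measurable.aemeasurable]
  simp only [Function.comp_def, blockForm_elliptical]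
  refine hm.mul_prod (g := fun u : UnitSphere p ↦
    blockForm S J (CFC.sqrt S *ᵥ (u : EuclideanSpace ℝ (Fin p)).ofLp) ^ m) ?_
  have hcont : Continuous fun u : UnitSphere p ↦
      blockForm S J (CFC.sqrt S *ᵥ (u : EuclideanSpace ℝ (Fin p)).ofLp) ^ m :=
    ((continuous_blockForm S J).comp (continuous_const.matrix_mulVec
      ((PiLp.continuous_ofLp 2 _).comp continuous_subtype_val))).pow m
  exact hcont.integrable_of_hasCompactSupport (HasCompactSupport.of_compactSpace _)

lemma integrable_pow_of_integrable_pow_two_mul (hν : IsRadialLaw p ν) {m : ℕ}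
    (h : Integrable (fun x ↦ x ^ (2 * (2 * m))) ν) : Integrable (fun x ↦ x ^ (2 * m)) ν := by
  have := hν.isProbabilityMeasure
  refine ((integrable_const (1 : ℝ)).add h).mono' (by fun_prop) (.of_forall fun x ↦ ?_)
  have e : x ^ (2 * (2 * m)) = (x ^ (2 * m)) ^ 2 := by rw [← pow_mul]; ring_nf
  have h0 : 0 ≤ x ^ (2 * m) := by rw [pow_mul]; positivity
  simp only [Pi.add_apply, e, Real.norm_of_nonneg h0]
  nlinarith [sq_nonneg (x ^ (2 * m) - 1)]

/-- Integrate $t\le 1+t^2$ with $t=p^{-m}\xi^{2m}$. -/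
lemma scaledMoment_le_one_add (hν : IsRadialLaw p ν) {m : ℕ}
    (h : Integrable (fun x ↦ x ^ (2 * (2 * m))) ν) :
    scaledMoment p ν m ≤ 1 + scaledMoment p ν (2 * m) := by
  have := hν.isProbabilityMeasure
  have h1 := integrable_pow_of_integrable_pow_two_mul hν h
  rw [scaledMoment, scaledMoment, ← integral_const_mul, ← integral_const_mul]
  have e : (1 : ℝ) = ∫ _x : ℝ, (1 : ℝ) ∂ν := by simp
  conv_rhs => rw [e]
  rw [← integral_add (integrable_const _) (h.const_mul _)]
  refine integral_mono (h1.const_mul _) ((integrable_const _).add (h.const_mul _)) fun x ↦ ?_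
  have e : ((p : ℝ) ^ (2 * m))⁻¹ * x ^ (2 * (2 * m)) = (((p : ℝ) ^ m)⁻¹ * x ^ (2 * m)) ^ 2 := by
    rw [mul_pow, inv_pow, ← pow_mul, ← pow_mul]; ring_nf
  simp only [e]
  nlinarith [sq_nonneg (((p : ℝ) ^ m)⁻¹ * x ^ (2 * m) - 1)]

lemma scaledMoment_nonneg (p : ℕ) (ν : Measure ℝ) (m : ℕ) : 0 ≤ scaledMoment p ν m :=
  mul_nonneg (by positivity) (integral_nonneg fun x ↦ by simp only [pow_mul]; positivity)

variable {K m : ℕ} {A : Finset (Finset (Fin p))}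

lemma integral_blockMean (hS : S.PosSemidef) (hν : IsRadialLaw p ν) (μ : Fin p → ℝ)
    (hA : IsBlockCollection K A) (hAS : ∀ J ∈ A, (diagBlock S J).PosDef)
    (hm : Integrable (fun x ↦ x ^ (2 * m)) ν) :
    ∫ x, blockMean m A S (x - μ) ∂ellipticalLaw μ S ν = scaledMoment p ν m := by
  obtain ⟨I, hI⟩ := hA.nonempty
  have hp : 0 < p := by obtain ⟨j, _⟩ := hA.block_nonempty I hI; exact j.pos
  simp only [blockMean]
  rw [integral_const_mul, integral_finsetSum _ fun J _ ↦
    (integrable_blockForm_pow hp hν μ J hm).const_mul _]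
  have h (J) (hJ : J ∈ A) : ∫ x, (cStar p m J.card)⁻¹ * blockForm S J (x - μ) ^ m
      ∂ellipticalLaw μ S ν = scaledMoment p ν m := by
    have hc := one_le_cStar (hA.block_nonempty J hJ).card_pos (by simpa using J.card_le_univ) m
    rw [integral_const_mul, integral_blockForm_pow hS hν μ (hA.block_nonempty J hJ) (hAS J hJ),
      inv_mul_cancel_left₀ (zero_lt_one.trans_le hc).ne']
  rw [Finset.sum_congr rfl h]
  have : (A.card : ℝ) ≠ 0 := by exact_mod_cast (Finset.card_pos.2 ⟨I, hI⟩).ne'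
  simp [this]

lemma memLp_blockMean (hp : 0 < p) (hν : IsRadialLaw p ν) (μ : Fin p → ℝ)
    (hm : Integrable (fun x ↦ x ^ (2 * (2 * m))) ν) :
    MemLp (fun x ↦ blockMean m A S (x - μ)) 2 (ellipticalLaw μ S ν) := by
  have h (J) : MemLp (fun x ↦ blockForm S J (x - μ) ^ m) 2 (ellipticalLaw μ S ν) := by
    rw [memLp_two_iff_integrable_sq (continuous_blockForm_sub_pow S J μ m).aestronglyMeasurable]
    simpa only [← pow_mul, mul_comm m 2] using integrable_blockForm_pow hp hν μ J hm
  simp only [blockMean]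
  exact (memLp_finsetSum A fun J _ ↦ (h J).const_mul (cStar p m J.card)⁻¹).const_mul
    (A.card : ℝ)⁻¹

/-- Cauchy–Schwarz over the blocks reduces to single-block moments of order $2m$. No variance
reduction across blocks is sought, since they share $\xi$. -/
lemma integral_blockMean_sq_le (hS : S.PosSemidef) (hν : IsRadialLaw p ν) (μ : Fin p → ℝ)
    (hA : IsBlockCollection K A) (hAS : ∀ J ∈ A, (diagBlock S J).PosDef)
    (hm : Integrable (fun x ↦ x ^ (2 * (2 * m))) ν) :
    ∫ x, blockMean m A S (x - μ) ^ 2 ∂ellipticalLaw μ S ν ≤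
      ((K : ℝ) + 2 * (2 * m : ℕ)) ^ (2 * m) * scaledMoment p ν (2 * m) := by
  obtain ⟨I, hI⟩ := hA.nonempty
  have hp : 0 < p := by obtain ⟨j, _⟩ := hA.block_nonempty I hI; exact j.pos
  have hcard : (0 : ℝ) < A.card := by exact_mod_cast Finset.card_pos.2 ⟨I, hI⟩
  have hint (J) : Integrable (fun x ↦ blockForm S J (x - μ) ^ (2 * m)) (ellipticalLaw μ S ν) :=
    integrable_blockForm_pow hp hν μ J hm
  calc ∫ x, blockMean m A S (x - μ) ^ 2 ∂ellipticalLaw μ S ν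
      ≤ ∫ x, (A.card : ℝ)⁻¹ * ∑ J ∈ A, blockForm S J (x - μ) ^ (2 * m)
          ∂ellipticalLaw μ S ν := by
        refine integral_mono (memLp_blockMean hp hν μ hm).integrable_sq
          ((integrable_finsetSum _ fun J _ ↦ hint J).const_mul _) fun x ↦ ?_
        simp only [blockMean, mul_pow]
        calc _ ≤ ((A.card : ℝ)⁻¹) ^ 2 * (A.card *
              ∑ J ∈ A, ((cStar p m J.card)⁻¹ * blockForm S J (x - μ) ^ m) ^ 2) := by
              gcongr
              exact sq_sum_le_card_mul_sum_sq
          _ = (A.card : ℝ)⁻¹ *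
              ∑ J ∈ A, ((cStar p m J.card)⁻¹ * blockForm S J (x - μ) ^ m) ^ 2 := by
              field_simp
          _ ≤ _ := by
              gcongr with J hJ
              have hc := one_le_cStar (hA.block_nonempty J hJ).card_pos
                (by simpa using J.card_le_univ) m
              rw [mul_pow, ← pow_mul, mul_comm m 2]
              have h0 : 0 ≤ blockForm S J (x - μ) ^ (2 * m) := by rw [pow_mul]; positivity
              refine mul_le_of_le_one_left h0 (pow_le_one₀ ?_ (inv_le_one_of_one_le₀ hc))
              exact inv_nonneg.2 (zero_le_one.trans hc)
    _ = (A.card : ℝ)⁻¹ * ∑ J ∈ A, cStar p (2 * m) J.card * scaledMoment p ν (2 * m) := by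
        rw [integral_const_mul, integral_finsetSum _ fun J _ ↦ hint J]
        congr 1
        exact Finset.sum_congr rfl fun J hJ ↦
          integral_blockForm_pow hS hν μ (hA.block_nonempty J hJ) (hAS J hJ) _
    _ ≤ (A.card : ℝ)⁻¹ * ∑ J ∈ A,
          ((K : ℝ) + 2 * (2 * m : ℕ)) ^ (2 * m) * scaledMoment p ν (2 * m) := by
        gcongr with J hJ
        · exact scaledMoment_nonneg p ν _
        · exact cStar_le (hA.block_nonempty J hJ).card_pos (by simpa using J.card_le_univ)
            (hA.block_card_le J hJ) _
    _ = _ := by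
        rw [Finset.sum_const, nsmul_eq_mul]
        field_simp

end EllipticalMoments

/-! ### Concentration of the oracle average -/

section Chebyshev

/-- Chebyshev's inequality for the empirical mean of a function of an i.i.d. sample. -/
lemma measureReal_average_sub_ge_le {Ω E : Type*} [MeasurableSpace Ω] [MeasurableSpace E]
    {P : Measure Ω} [IsProbabilityMeasure P] {n : ℕ} (hn : 0 < n) {Y : Fin n → Ω → E}
    {Q : Measure E} (hind : iIndepFun Y P) (hlaw : ∀ i, HasLaw (Y i) Q P) {g : E → ℝ}
    (hg : Measurable g) (hg2 : MemLp g 2 Q) {V D : ℝ} (hV : ∫ x, g x ^ 2 ∂Q ≤ V) (hD : 0 < D) :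
    P.real {ω | D * (n : ℝ) ^ (-(1 / 2) : ℝ) ≤ |(n : ℝ)⁻¹ * ∑ i, g (Y i ω) - ∫ x, g x ∂Q|} ≤
      V / D ^ 2 := by
  have hn' : (0 : ℝ) < n := by exact_mod_cast hn
  let X : Fin n → Ω → ℝ := fun i ω ↦ g (Y i ω)
  have hX (i) : MemLp (X i) 2 P := by
    refine MemLp.comp_of_map (f := Y i) ?_ (hlaw i).aemeasurable
    rwa [(hlaw i).map_eq]
  have hmean (i) : ∫ ω, X i ω ∂P = ∫ x, g x ∂Q :=
    (hlaw i).integral_comp hg.aestronglyMeasurable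
  have hvar (i) : variance (X i) P ≤ V := by
    refine (variance_le_expectation_sq (hX i).1).trans ?_
    have h := (hlaw i).integral_comp (f := fun x ↦ g x ^ 2)
      (hg.pow_const 2).aestronglyMeasurable
    simp only [Function.comp_apply] at h
    simpa only [X, Pi.pow_apply, h] using hV
  have hXind : iIndepFun X P := hind.comp (fun _ ↦ g) fun _ ↦ hg
  let Z : Ω → ℝ := fun ω ↦ (n : ℝ)⁻¹ * (∑ i, X i) ω
  have hsum : MemLp (∑ i, X i) 2 P := memLp_finsetSum' _ fun i _ ↦ hX i
  have hZ : MemLp Z 2 P := hsum.const_mul _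
  have hZmean : ∫ ω, Z ω ∂P = ∫ x, g x ∂Q := by
    simp only [Z, Finset.sum_apply]
    rw [integral_const_mul, integral_finsetSum _ fun i _ ↦ (hX i).integrable one_le_two,
      Finset.sum_congr rfl fun i _ ↦ hmean i]
    simp [hn'.ne']
  have hZvar : variance Z P ≤ V / n := by
    rw [variance_const_mul, IndepFun.variance_sum (fun i _ ↦ hX i)
      fun i _ j _ hij ↦ hXind.indepFun hij]
    calc ((n : ℝ)⁻¹) ^ 2 * ∑ i, variance (X i) P ≤ ((n : ℝ)⁻¹) ^ 2 * ∑ _i : Fin n, V := by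
          gcongr with i
          exact hvar i
      _ = V / n := by
          simp; field_simp
  have hr : (0 : ℝ) < (n : ℝ) ^ (-(1 / 2) : ℝ) := Real.rpow_pos_of_pos hn' _
  have hr2 : ((n : ℝ) ^ (-(1 / 2) : ℝ)) ^ 2 = (n : ℝ)⁻¹ := by
    rw [← Real.rpow_natCast, ← Real.rpow_mul hn'.le]
    norm_num
    exact Real.rpow_neg_one _
  have hcheb := meas_ge_le_variance_div_sq hZ (mul_pos hD hr)
  rw [hZmean] at hcheb
  have hV0 : 0 ≤ V := (integral_nonneg fun x ↦ sq_nonneg (g x)).trans hV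
  have hset : {ω | D * (n : ℝ) ^ (-(1 / 2) : ℝ) ≤
      |(n : ℝ)⁻¹ * ∑ i, g (Y i ω) - ∫ x, g x ∂Q|} =
      {ω | D * (n : ℝ) ^ (-(1 / 2) : ℝ) ≤ |Z ω - ∫ x, g x ∂Q|} := by
    simp [Z, X]
  rw [hset]
  refine (ENNReal.toReal_le_of_le_ofReal (by
    have := variance_nonneg Z P; positivity) hcheb).trans ?_
  rw [mul_pow, hr2]
  calc variance Z P / (D ^ 2 * (n : ℝ)⁻¹) ≤ (V / n) / (D ^ 2 * (n : ℝ)⁻¹) := by gcongr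
    _ = V / D ^ 2 := by field_simp

end Chebyshev

/-! ### From oracle to plug-in estimator, and the final bound -/

lemma posDef_diagBlock {p : ℕ} {S : Matrix (Fin p) (Fin p) ℝ} (hS : S.PosSemidef)
    {J : Finset (Fin p)} {c : ℝ} (hc : 0 < c)
    (h : ∀ x : J → ℝ, c * (x ⬝ᵥ x) ≤ x ⬝ᵥ (diagBlock S J *ᵥ x)) : (diagBlock S J).PosDef := by
  classical
  have h1 : (diagBlock S J).PosSemidef := hS.submatrix _
  exact h1.posDef_iff_isUnit.2 (isUnit_of_mulVec_bound hc h)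

/-- The plug-in error bound, on the event where the oracle estimator and the nuisance estimators
are accurate. -/
lemma abs_bae_sub_le {n p m K : ℕ} (hn : 0 < n) {A : Finset (Finset (Fin p))}
    (hA : IsBlockCollection K A) {S S' : Matrix (Fin p) (Fin p) ℝ} (hS : S.PosSemidef)
    {c δ : ℝ} (hc : 0 < c)
    (hSc : ∀ J ∈ A, ∀ x : J → ℝ, c * (x ⬝ᵥ x) ≤ x ⬝ᵥ (diagBlock S J *ᵥ x))
    (hδ0 : 0 ≤ δ) (hδ1 : δ ≤ 1) (hδc : δ ≤ c / 2)
    (hE : ∀ J ∈ A, ‖diagBlock S' J - diagBlock S J‖ ≤ δ) (Y : Fin n → Fin p → ℝ)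
    {a a' : Fin p → ℝ} (ha : ‖a' - a‖ ≤ δ) :
    |bae m Y A a' S' - bae m Y A a S| ≤ δ * (stabilityConst m K c * (1 + bae m Y A a S)) := by
  have hn' : (0 : ℝ) < n := by exact_mod_cast hn
  have hcs (J) (hJ : J ∈ A) : 1 ≤ cStar p m J.card :=
    one_le_cStar (hA.block_nonempty J hJ).card_pos (by simpa using J.card_le_univ) m
  have h (i : Fin n) : |blockMean m A S' (Y i - a') - blockMean m A S (Y i - a)| ≤
      δ * (stabilityConst m K c * (1 + blockMean m A S (Y i - a))) := by
    have := abs_blockMean_sub_le hA hS hc hSc hcs hδ0 hδ1 hδc hE (Y i - a) (a' - a) ha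
    rwa [sub_sub_sub_cancel_right] at this
  rw [bae_eq_average, bae_eq_average, ← mul_sub, ← Finset.sum_sub_distrib, abs_mul,
    abs_of_nonneg (by positivity)]
  calc _ ≤ (n : ℝ)⁻¹ *
        ∑ i, δ * (stabilityConst m K c * (1 + blockMean m A S (Y i - a))) := by
        gcongr
        exact (Finset.abs_sum_le_sum_abs _ _).trans (Finset.sum_le_sum fun i _ ↦ h i)
    _ = _ := by
        simp only [← Finset.mul_sum, Finset.sum_add_distrib]
        simp only [Finset.sum_const, nsmul_eq_mul, mul_one, Finset.card_univ, Fintype.card_fin]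
        field_simp

end BlockAgg

/-- Consistency of the plug-in blockwise aggregation estimator, with general mean and covariance
estimators. `‖·‖` is the sup norm on `Fin p → ℝ` and the spectral norm on matrices. -/
theorem theorem6 (m K : ℕ) (hm : 2 ≤ m) (hK : 1 ≤ K) (c₀ C₀ : ℝ) (hc₀ : 0 < c₀)
    (ε : ℝ) (hε : 0 < ε) :
    ∃ Cε : ℝ, 0 < Cε ∧
      ∀ (p : ℕ → ℕ) (Ω : ℕ → Type u) [∀ n, MeasurableSpace (Ω n)]
        (P : ∀ n, Measure (Ω n)) [∀ n, IsProbabilityMeasure (P n)]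
        (μ : ∀ n, Fin (p n) → ℝ)
        (S : ∀ n, Matrix (Fin (p n)) (Fin (p n)) ℝ)
        (hS : ∀ n, (S n).PosSemidef)
        (ν : ℕ → Measure ℝ)
        (Y : ∀ n, Fin n → Ω n → Fin (p n) → ℝ)
        (A : ∀ n, Finset (Finset (Fin (p n))))
        (μhat : ∀ n, Ω n → Fin (p n) → ℝ)
        (Shat : ∀ n, Ω n → Matrix (Fin (p n)) (Fin (p n)) ℝ)
        (α β : ℕ → ℝ),
        Tendsto p atTop atTop →
        (fun n => Real.log (p n) ^ (2 * m)) =o[atTop] (fun n => (n : ℝ)) →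
        (∀ n, BlockAgg.IsRadialLaw (p n) (ν n)) →
        (∀ n, Integrable (fun x => x ^ (2 * (2 * m))) (ν n)) →
        (∀ n, BlockAgg.scaledMoment (p n) (ν n) (2 * m) ≤ C₀) →
        (∀ n, ∀ J : Finset (Fin (p n)), J.card = K →
          ∀ j, c₀ ≤ (BlockAgg.isHermitian_diagBlock (hS n) J).eigenvalues j) →
        (∀ n, BlockAgg.IsBlockCollection K (A n)) →
        (∀ n, iIndepFun (Y n) (P n)) →
        (∀ n i, HasLaw (Y n i) (BlockAgg.ellipticalLaw (μ n) (S n) (ν n)) (P n)) →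
        (∀ n, AEMeasurable (μhat n) (P n)) →
        (∀ n j k, AEMeasurable (fun ω => Shat n ω j k) (P n)) →
        Tendsto α atTop (𝓝 0) →
        Tendsto β atTop (𝓝 0) →
        Tendsto (fun n => (P n).real {ω | ‖μhat n ω - μ n‖ ≤ α n ∧
          ∀ J ∈ A n, ‖BlockAgg.diagBlock (Shat n ω) J - BlockAgg.diagBlock (S n) J‖ ≤ β n})
          atTop (𝓝 1) →
        ∀ᶠ n in atTop, 1 - ε ≤ (P n).real {ω |
          |BlockAgg.bae m (fun i => Y n i ω) (A n) (μhat n ω) (Shat n ω)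
              - BlockAgg.scaledMoment (p n) (ν n) m|
            ≤ Cε * ((n : ℝ) ^ (-(1 / 2) : ℝ) + max (α n) (β n))} := by
  -- `V` bounds the second moment of one summand; `max C₀ 1` keeps it positive whatever the sign of
  -- `C₀`. `D` below makes the Chebyshev failure probability $\varepsilon/2$.
  obtain ⟨V, hVdef⟩ : ∃ V : ℝ, V = ((K : ℝ) + 2 * (2 * m : ℕ)) ^ (2 * m) * max C₀ 1 := ⟨_, rfl⟩
  have hV : 0 < V := by
    have : (0 : ℝ) < K := by exact_mod_cast hK
    rw [hVdef]; positivity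
  obtain ⟨D, hD, hDV⟩ : ∃ D : ℝ, 0 < D ∧ V / D ^ 2 = ε / 2 := by
    refine ⟨√(2 * V / ε), by positivity, ?_⟩
    rw [Real.sq_sqrt (by positivity)]
    field_simp
  obtain ⟨C₁, hC₁, hC₁0⟩ : ∃ C₁, C₁ = BlockAgg.stabilityConst m K c₀ ∧ 0 ≤ C₁ :=
    ⟨_, rfl, BlockAgg.stabilityConst_nonneg m K hc₀⟩
  -- The first term is $C_1$ times a bound for one plus the oracle estimator; the last `D` is the
  -- Chebyshev fluctuation.
  refine ⟨C₁ * (2 + max C₀ 1 + D) + D, by positivity, ?_⟩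
  intro p Ω _ P _ μ S hS ν Y A μhat Shat α β hp _ hν hint hmom heig hA hind hlaw _ _ hα hβ hhat
  filter_upwards [eventually_gt_atTop 0, hp.eventually_ge_atTop K,
    hα.eventually_le_const zero_lt_one, hβ.eventually_le_const zero_lt_one,
    hα.eventually_le_const (half_pos hc₀), hβ.eventually_le_const (half_pos hc₀),
    hhat.eventually_const_le (show 1 - ε / 2 < 1 by linarith)]
    with n hn hKp hα1 hβ1 hαc hβc hprob
  have hSc (J) (hJ : J ∈ A n) (x : J → ℝ) :=
    BlockAgg.le_dotProduct_diagBlock_mulVec hKp (hS n) (heig n) ((hA n).block_card_le J hJ) x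
  have hpd (J) (hJ : J ∈ A n) := BlockAgg.posDef_diagBlock (hS n) hc₀ (hSc J hJ)
  obtain ⟨I, hI⟩ := (hA n).nonempty
  have hp0 : 0 < p n := by
    obtain ⟨j, _⟩ := (hA n).block_nonempty I hI
    exact j.pos
  have hθ : BlockAgg.scaledMoment (p n) (ν n) m ≤ 1 + max C₀ 1 :=
    (BlockAgg.scaledMoment_le_one_add (hν n) (hint n)).trans
      (by gcongr; exact (hmom n).trans (le_max_left _ _))
  have hcheb := BlockAgg.measureReal_average_sub_ge_le hn (hind n) (hlaw n)
    (g := fun x ↦ BlockAgg.blockMean m (A n) (S n) (x - μ n))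
    ((BlockAgg.continuous_blockMean m (A n) (S n)).comp (continuous_sub_right (μ n))).measurable
    (BlockAgg.memLp_blockMean hp0 (hν n) (μ n) (hint n)) (V := V)
    ((BlockAgg.integral_blockMean_sq_le (hS n) (hν n) (μ n) (hA n) hpd (hint n)).trans (by
      rw [hVdef]
      gcongr
      exact (hmom n).trans (le_max_left _ _))) hD
  rw [hDV, BlockAgg.integral_blockMean (hS n) (hν n) (μ n) (hA n) hpd
    (BlockAgg.integrable_pow_of_integrable_pow_two_mul (hν n) (hint n))] at hcheb
  simp only [← BlockAgg.bae_eq_average m (fun i ↦ Y n i _)] at hcheb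
  have hr0 : 0 ≤ (n : ℝ) ^ (-(1 / 2) : ℝ) := by positivity
  have hr1 : (n : ℝ) ^ (-(1 / 2) : ℝ) ≤ 1 :=
    Real.rpow_le_one_of_one_le_of_nonpos (by exact_mod_cast hn) (by norm_num)
  set r := (n : ℝ) ^ (-(1 / 2) : ℝ)
  set θ := BlockAgg.scaledMoment (p n) (ν n) m
  -- The event where the nuisance estimates are accurate lies in the union of the target event and
  -- the Chebyshev failure event.
  refine le_of_add_le_add_right (a := ε / 2) ?_
  calc 1 - ε + ε / 2 = 1 - ε / 2 := by ring
    _ ≤ _ := hprob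
    _ ≤ _ := measureReal_mono (fun ω hω ↦ ?_) (measure_ne_top _ _)
    _ ≤ _ := measureReal_union_le _ _
    _ ≤ _ := add_le_add_right hcheb _
  by_cases hω' : D * r ≤
      |BlockAgg.bae m (fun i ↦ Y n i ω) (A n) (μ n) (S n) - θ|
  · exact Or.inr hω'
  left
  rw [not_le] at hω'
  obtain ⟨h1, h2⟩ := hω
  have hδ0 : 0 ≤ max (α n) (β n) := (norm_nonneg _).trans (h1.trans (le_max_left _ _))
  have hpert := BlockAgg.abs_bae_sub_le (m := m) hn (hA n) (hS n) hc₀ hSc hδ0 (max_le hα1 hβ1)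
    (max_le hαc hβc) (fun J hJ ↦ (h2 J hJ).trans (le_max_right _ _)) (fun i ↦ Y n i ω)
    (h1.trans (le_max_left _ _))
  rw [← hC₁] at hpert
  set δ := max (α n) (β n)
  set b := BlockAgg.bae m (fun i ↦ Y n i ω) (A n) (μ n) (S n)
  set b' := BlockAgg.bae m (fun i ↦ Y n i ω) (A n) (μhat n ω) (Shat n ω)
  change |b' - θ| ≤ _
  have hb : 1 + b ≤ 2 + max C₀ 1 + D := by
    have := (abs_le.1 hω'.le).2
    have : D * r ≤ D := mul_le_of_le_one_right hD.le hr1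
    linarith
  have hM : 0 ≤ C₁ * (2 + max C₀ 1 + D) := by positivity
  calc |b' - θ| ≤ |b' - b| + |b - θ| := abs_sub_le _ _ _
    _ ≤ δ * (C₁ * (2 + max C₀ 1 + D)) + D * r :=
        add_le_add (hpert.trans (by gcongr)) hω'.le
    _ ≤ _ := by nlinarith [mul_nonneg hM hr0, mul_nonneg hD.le hδ0]
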